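/- Let $X, X_1, X_2, \ldots$ be i.i.d. real-valued random variables, let $S_0 = 0$ and $S_n = \sum_{i=1}^n X_i$ for $n \ge 1$, and let $G_0 = 0$ and $G_n = \frac{1}{n} \sum_{i=1}^n S_i$ for $n \ge 1$. Suppose that either of the following two conditions holds: (i) $0 < \mathbb{E}|X| < \infty$ and $X$ has the same distribution as $-X$; (ii) $\mathbb{E}[X^2] < \infty$, $\operatorname{Var}(X) > 0$ and $\mathbb{E} X = 0$. Then, almost surely, $\liminf_{n\to\infty} G_n = -\infty$, $\limsup_{n\to\infty} G_n = +\infty$, and $\liminf_{n\to\infty} |G_n - x| = 0$ for every $x \in \mathbb{R}$. In particular, $(G_n)$ is recurrent, in the sense that, almost surely, for every $x \in \mathbb{R}$ and every $\varepsilon > 0$ one has $|G_n - x| < \varepsilon$ for infinitely many $n$. -/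

import Mathlib

open MeasureTheory ProbabilityTheory Filter

noncomputable section

/-- The random walk `S_n = X_1 + ⋯ + X_n` on `ℝ` with `S_0 = 0`.  The sequence of increments is
indexed from `0`, so that `X i` is the increment `X_{i+1}`. -/
def walk {Ω : Type*} (X : ℕ → Ω → ℝ) (n : ℕ) (ω : Ω) : ℝ :=
  ∑ i ∈ Finset.range n, X i ω

/-- The centre of mass process `G_n = (1/n) (S_1 + ⋯ + S_n)` for `n ≥ 1`, with `G_0 = 0`. -/
def centreOfMass {Ω : Type*} (X : ℕ → Ω → ℝ) (n : ℕ) (ω : Ω) : ℝ :=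
  if n = 0 then 0 else (1 / (n : ℝ)) * ∑ i ∈ Finset.Icc 1 n, walk X i ω

end

open scoped Topology

/-! Let `L` be the upper limit of `G_n` in the extended reals. Deleting the first step turns `G`
into a centre of mass with the same law, and by the law of large numbers `L = X_0 + L'` with `L'`
independent of `X_0` and distributed as `L` (`seqLimsup_eq_add_head`). The events `L = ⊤` and `L =
⊥` are tail events; if both were null, `L` would be finite, and characteristic functions would force
`X_0 = 0`. So `L` is a.s. `⊤` or a.s. `⊥` (`seqLimsup_ae_eq_top_or_bot`).

The value `⊥` means `G_n → -∞`. For symmetric steps `-G_n → -∞` as well, which is absurd. For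
centred square integrable steps, `P(G_n > 0) → 0` together with `E G_n = 0` and `E G_n² = O(n)`
gives `E|G_n| = o(√n)`, hence `E|S_n| = o(√n)`, against the central limit theorem.

Thus `L = ⊤`, and applying this to `-X` gives lower limit `⊥`. Since `G_{n+1} - G_n → 0`, the
process cannot jump over any level. -/

/-- The centre of mass process of the walk with deterministic increments `x`. -/
noncomputable def seqCentre (x : ℕ → ℝ) (n : ℕ) : ℝ :=
  centreOfMass (fun i (y : ℕ → ℝ) => y i) n x

/-- The upper limit of the centre of mass process, in the extended reals. -/
noncomputable def seqLimsup (x : ℕ → ℝ) : EReal :=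
  limsup (fun n => (seqCentre x n : EReal)) atTop

/-! ### Deterministic identities and bounds -/

/-- The increment `x j` enters exactly the `n - j` partial sums with index in `(j, n]`. -/
theorem sum_walk_eq_weighted_sum (x : ℕ → ℝ) (n : ℕ) :
    ∑ i ∈ Finset.Icc 1 n, ∑ j ∈ Finset.range i, x j =
      ∑ j ∈ Finset.range n, ((n : ℝ) - j) * x j := by
  induction n with
  | zero => simp
  | succ n ih =>
    rw [Finset.sum_Icc_succ_top (by omega), ih, Finset.sum_range_succ, Finset.sum_range_succ,
      ← add_assoc, ← Finset.sum_add_distrib]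
    congr 1
    · refine Finset.sum_congr rfl fun j _ => ?_
      push_cast; ring
    · push_cast; ring

theorem seqCentre_eq (x : ℕ → ℝ) (n : ℕ) :
    seqCentre x n = (n : ℝ)⁻¹ * ∑ j ∈ Finset.range n, ((n : ℝ) - j) * x j := by
  rw [← sum_walk_eq_weighted_sum]
  unfold seqCentre centreOfMass walk
  split_ifs with h
  · simp [h]
  · rw [one_div]

theorem natCast_mul_seqCentre (x : ℕ → ℝ) (n : ℕ) :
    (n : ℝ) * seqCentre x n = ∑ j ∈ Finset.range n, ((n : ℝ) - j) * x j := by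
  rcases eq_or_ne n 0 with rfl | hn
  · simp
  · rw [seqCentre_eq, mul_inv_cancel_left₀ (by exact_mod_cast hn)]

theorem measurable_seqCentre (n : ℕ) : Measurable fun x : ℕ → ℝ => seqCentre x n := by
  simp only [seqCentre_eq]
  fun_prop

theorem measurable_seqLimsup : Measurable seqLimsup :=
  Measurable.limsup fun n => (measurable_seqCentre n).coe_real_ereal

theorem seqCentre_neg (x : ℕ → ℝ) (n : ℕ) : seqCentre (-x) n = -seqCentre x n := by
  simp [seqCentre_eq]

theorem seqCentre_sub (x y : ℕ → ℝ) (n : ℕ) :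
    seqCentre (x - y) n = seqCentre x n - seqCentre y n := by
  simp [seqCentre_eq, mul_sub, Finset.sum_sub_distrib]

theorem abs_seqCentre_le (x : ℕ → ℝ) (n : ℕ) :
    |seqCentre x n| ≤ ∑ j ∈ Finset.range n, |x j| := by
  rcases eq_or_ne n 0 with rfl | hn
  · simp [seqCentre_eq]
  have hn' : (0 : ℝ) < n := by positivity
  rw [seqCentre_eq, abs_mul, abs_of_pos (inv_pos.2 hn'), inv_mul_le_iff₀ hn', Finset.mul_sum]
  refine (Finset.abs_sum_le_sum_abs _ _).trans (Finset.sum_le_sum fun j hj => ?_)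
  have hj' : (j : ℝ) ≤ n := by exact_mod_cast (Finset.mem_range.1 hj).le
  rw [abs_mul, abs_of_nonneg (by linarith)]
  have : (0 : ℝ) ≤ j := by positivity
  gcongr
  linarith

theorem seqCentre_succ_eq_head_add (x : ℕ → ℝ) (n : ℕ) :
    seqCentre x (n + 1) = seqCentre (fun i => x (i + 1)) n +
      (x 0 - seqCentre (fun i => x (i + 1)) n / (n + 1 : ℕ)) := by
  have h1 := natCast_mul_seqCentre x (n + 1)
  have h2 := natCast_mul_seqCentre (fun i => x (i + 1)) n
  rw [Finset.sum_range_succ'] at h1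
  have h3 : ∑ k ∈ Finset.range n, (((n + 1 : ℕ) : ℝ) - (k + 1 : ℕ)) * x (k + 1) =
      ∑ j ∈ Finset.range n, ((n : ℝ) - j) * x (j + 1) :=
    Finset.sum_congr rfl fun j _ => by push_cast; ring
  rw [h3, ← h2] at h1
  have hn : (n : ℝ) + 1 ≠ 0 := by positivity
  push_cast at h1 ⊢
  field_simp
  linarith

theorem seqCentre_succ_sub (x : ℕ → ℝ) (n : ℕ) :
    seqCentre x (n + 1) - seqCentre x n =
      (∑ i ∈ Finset.range (n + 1), x i) / (n + 1 : ℕ) - seqCentre x n / (n + 1 : ℕ) := by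
  have h1 := natCast_mul_seqCentre x (n + 1)
  have h2 := natCast_mul_seqCentre x n
  rw [← sum_walk_eq_weighted_sum, Finset.sum_Icc_succ_top (by omega),
    sum_walk_eq_weighted_sum, ← h2] at h1
  have hn : (n : ℝ) + 1 ≠ 0 := by positivity
  push_cast at h1 ⊢
  field_simp
  linarith

/-- Splitting the walk at time `n`. -/
theorem sum_range_eq_seqCentre (x : ℕ → ℝ) {n : ℕ} (hn : n ≠ 0) :
    ∑ i ∈ Finset.range n, x i =
      2 * seqCentre x (n + n) - seqCentre x n - seqCentre (fun i => x (n + i)) n := by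
  have h1 := natCast_mul_seqCentre x (n + n)
  have h2 := natCast_mul_seqCentre x n
  have h3 := natCast_mul_seqCentre (fun i => x (n + i)) n
  rw [Finset.sum_range_add] at h1
  have h4 : ∑ k ∈ Finset.range n, (((n + n : ℕ) : ℝ) - (n + k : ℕ)) * x (n + k) =
      ∑ j ∈ Finset.range n, ((n : ℝ) - j) * x (n + j) :=
    Finset.sum_congr rfl fun j _ => by push_cast; ring
  -- The weight `2n - k` splits as `n + (n - k)`.
  have h5 : ∑ k ∈ Finset.range n, (((n + n : ℕ) : ℝ) - k) * x k =
      n * ∑ i ∈ Finset.range n, x i + ∑ j ∈ Finset.range n, ((n : ℝ) - j) * x j := by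
    rw [Finset.mul_sum, ← Finset.sum_add_distrib]
    exact Finset.sum_congr rfl fun j _ => by push_cast; ring
  rw [h4, h5, ← h2, ← h3] at h1
  have hn' : (n : ℝ) ≠ 0 := by exact_mod_cast hn
  push_cast at h1
  apply mul_left_cancel₀ hn'
  linarith

/-! ### Consequences of `S_n / n → 0` -/

/-- For `1 ≤ i ≤ n` one has `|S_i| / n ≤ |S_i| / i`, so `|G_n| / n` is at most a Cesàro mean of
`|S_i / i|`. -/
theorem tendsto_seqCentre_div {x : ℕ → ℝ}
    (hx : Tendsto (fun n : ℕ => (∑ i ∈ Finset.range n, x i) / n) atTop (𝓝 0)) :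
    Tendsto (fun n : ℕ => seqCentre x n / n) atTop (𝓝 0) := by
  have h0 : Tendsto (fun n : ℕ => |(∑ i ∈ Finset.range (n + 1), x i) / (n + 1 : ℕ)|) atTop
      (𝓝 0) := by
    simpa using (hx.comp (tendsto_add_atTop_nat 1)).abs
  refine squeeze_zero_norm (fun n => ?_) h0.cesaro
  rcases eq_or_ne n 0 with rfl | hn
  · simp [seqCentre_eq]
  have hn' : (0 : ℝ) < n := by positivity
  rw [seqCentre_eq, ← sum_walk_eq_weighted_sum, Real.norm_eq_abs, mul_div_assoc, abs_mul,
    abs_of_pos (inv_pos.2 hn')]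
  refine mul_le_mul_of_nonneg_left ?_ (inv_pos.2 hn').le
  rw [Finset.range_eq_Ico,
    Finset.sum_Ico_add' (fun i : ℕ => |(∑ j ∈ Finset.range i, x j) / (i : ℕ)|) 0 n 1,
    abs_div, abs_of_pos hn', div_le_iff₀ hn', Finset.sum_mul]
  refine (Finset.abs_sum_le_sum_abs _ _).trans ?_
  rw [show Finset.Ico (0 + 1) (n + 1) = Finset.Icc 1 n by ext; simp]
  refine Finset.sum_le_sum fun i hi => ?_
  obtain ⟨hi1, hi2⟩ := Finset.mem_Icc.1 hi
  have hi' : (0 : ℝ) < i := by exact_mod_cast hi1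
  rw [abs_div, abs_of_pos hi', div_mul_eq_mul_div, le_div_iff₀ hi']
  exact mul_le_mul_of_nonneg_left (by exact_mod_cast hi2) (abs_nonneg _)

theorem tendsto_seqCentre_div_succ {x : ℕ → ℝ}
    (hx : Tendsto (fun n : ℕ => (∑ i ∈ Finset.range n, x i) / n) atTop (𝓝 0)) :
    Tendsto (fun n : ℕ => seqCentre x n / (n + 1 : ℕ)) atTop (𝓝 0) := by
  refine squeeze_zero_norm (fun n => ?_)
    (tendsto_zero_iff_norm_tendsto_zero.1 (tendsto_seqCentre_div hx))
  rcases eq_or_ne n 0 with rfl | hn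
  · simp [seqCentre_eq]
  have hn' : (0 : ℝ) < n := by positivity
  rw [norm_div, norm_div, Real.norm_natCast, Real.norm_natCast]
  gcongr
  simp

theorem tendsto_seqCentre_succ_sub {x : ℕ → ℝ}
    (hx : Tendsto (fun n : ℕ => (∑ i ∈ Finset.range n, x i) / n) atTop (𝓝 0)) :
    Tendsto (fun n : ℕ => seqCentre x (n + 1) - seqCentre x n) atTop (𝓝 0) := by
  simp only [seqCentre_succ_sub]
  simpa using (hx.comp (tendsto_add_atTop_nat 1)).sub (tendsto_seqCentre_div_succ hx)

/-- A real sequence with vanishing increments that is frequently above and frequently below `x`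
comes frequently close to `x`. -/
theorem frequently_abs_sub_lt_of_increments {u : ℕ → ℝ} {x ε : ℝ} (hε : 0 < ε)
    (hinc : Tendsto (fun n => u (n + 1) - u n) atTop (𝓝 0))
    (hlow : ∃ᶠ n in atTop, u n < x) (hhigh : ∃ᶠ n in atTop, x < u n) :
    ∃ᶠ n in atTop, |u n - x| < ε := by
  rw [frequently_atTop]
  intro a
  obtain ⟨N, hN⟩ := (Metric.tendsto_atTop.1 hinc) ε hε
  obtain ⟨m, hm, hmx⟩ := frequently_atTop.1 hlow (max a N)
  obtain ⟨k, hk, hkx⟩ := frequently_atTop.1 hhigh m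
  by_contra! hfar
  -- Avoiding the `ε`-neighbourhood of `x`, an upcrossing would need a jump of at least `2 * ε`.
  have key : ∀ j, m ≤ j → u j < x := by
    intro j hj
    induction j, hj using Nat.le_induction with
    | base => exact hmx
    | succ j hj ih =>
      have h1 := hN j (by omega)
      have h2 := hfar j (by omega)
      have h3 := hfar (j + 1) (by omega)
      rw [Real.dist_eq, sub_zero, abs_lt] at h1
      rw [abs_of_neg (by linarith)] at h2
      by_contra! h4
      rw [abs_of_nonneg (by linarith)] at h3
      linarith
  exact absurd (key k hk) hkx.not_gt

/-! ### Upper limits in the extended reals, and changing finitely many steps -/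

theorem limsup_coe_eq_top_iff {u : ℕ → ℝ} :
    limsup (fun n => (u n : EReal)) atTop = ⊤ ↔ ∀ M : ℝ, ∃ᶠ n in atTop, M < u n := by
  constructor
  · intro h M
    have : (M : EReal) < limsup (fun n => (u n : EReal)) atTop := h ▸ EReal.coe_lt_top M
    exact (frequently_lt_of_lt_limsup (by isBoundedDefault) this).mono fun n hn => by
      exact_mod_cast hn
  · intro h
    rw [EReal.eq_top_iff_forall_lt]
    intro M
    refine lt_of_lt_of_le (EReal.coe_lt_coe_iff.2 (lt_add_one M)) ?_
    exact le_limsup_of_frequently_le ((h (M + 1)).mono fun n hn => by exact_mod_cast hn.le)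

theorem limsup_coe_eq_bot_iff {u : ℕ → ℝ} :
    limsup (fun n => (u n : EReal)) atTop = ⊥ ↔ Tendsto u atTop atBot := by
  rw [← EReal.tendsto_coe_nhds_bot_iff]
  constructor
  · intro h
    exact tendsto_of_le_liminf_of_limsup_le bot_le h.le
  · intro h
    exact h.limsup_eq

theorem limsup_coe_neg_eq_top_iff {u : ℕ → ℝ} :
    limsup (fun n => ((-u n : ℝ) : EReal)) atTop = ⊤ ↔
      liminf (fun n => (u n : EReal)) atTop = ⊥ := by
  have : (fun n => ((-u n : ℝ) : EReal)) = -fun n => (u n : EReal) := by ext; simp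
  rw [this, EReal.limsup_neg, EReal.neg_eq_top_iff]

theorem liminf_abs_sub_eq_zero {u : ℕ → ℝ} {x : ℝ}
    (h : ∀ ε : ℝ, 0 < ε → ∃ᶠ n in atTop, |u n - x| < ε) :
    liminf (fun n => ((|u n - x| : ℝ) : EReal)) atTop = 0 := by
  apply le_antisymm
  · refine EReal.le_of_forall_lt_iff_le.1 fun ε hε => ?_
    exact liminf_le_of_frequently_le ((h ε (by exact_mod_cast hε)).mono fun n hn => by
      exact_mod_cast hn.le)
  · exact le_liminf_of_le (by isBoundedDefault) (Eventually.of_forall fun n => by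
      exact_mod_cast abs_nonneg _)

theorem limsup_coe_add_of_tendsto {u v : ℕ → ℝ} {c : ℝ} (hv : Tendsto v atTop (𝓝 c)) :
    limsup (fun n => ((u n + v n : ℝ) : EReal)) atTop =
      limsup (fun n => (u n : EReal)) atTop + c := by
  have hv' : Tendsto (fun n => (v n : EReal)) atTop (𝓝 (c : EReal)) := EReal.tendsto_coe.2 hv
  have : (fun n => ((u n + v n : ℝ) : EReal)) =
      (fun n => (u n : EReal)) + fun n => (v n : EReal) := by ext; simp
  rw [this]
  apply le_antisymm
  · refine (EReal.limsup_add_le ?_ ?_).trans_eq ?_ <;> simp [hv'.limsup_eq]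
  · refine le_trans (le_of_eq ?_) EReal.le_limsup_add
    rw [hv'.liminf_eq]

theorem seqLimsup_eq_add_head {x : ℕ → ℝ}
    (hx : Tendsto (fun n : ℕ => (∑ i ∈ Finset.range n, x (i + 1)) / n) atTop (𝓝 0)) :
    seqLimsup x = seqLimsup (fun i => x (i + 1)) + x 0 := by
  unfold seqLimsup
  rw [← limsup_nat_add _ 1]
  simp only [seqCentre_succ_eq_head_add]
  apply limsup_coe_add_of_tendsto
  simpa using (tendsto_const_nhds (x := x 0)).sub (tendsto_seqCentre_div_succ hx)

/-- The weights `(n - j) / n` lie in `[0, 1]`, so the bound is uniform in `n`; this makes infinite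
upper limits tail events. -/
theorem abs_seqCentre_sub_le_of_eq_of_ge {x y : ℕ → ℝ} {k : ℕ} (h : ∀ i, k ≤ i → x i = y i)
    (n : ℕ) :
    |seqCentre x n - seqCentre y n| ≤ ∑ j ∈ Finset.range k, |x j - y j| := by
  rw [← seqCentre_sub]
  refine (abs_seqCentre_le _ n).trans ?_
  rw [← Finset.sum_filter_of_ne (p := fun j => j < k)]
  · exact Finset.sum_le_sum_of_subset_of_nonneg (fun j hj => by simp_all) fun _ _ _ => abs_nonneg _
  · intro j _ hj
    by_contra! hk
    simp [h j hk] at hj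

theorem seqLimsup_eq_top_of_eventually_eq {x y : ℕ → ℝ} {k : ℕ} (h : ∀ i, k ≤ i → x i = y i)
    (hx : seqLimsup x = ⊤) : seqLimsup y = ⊤ := by
  refine limsup_coe_eq_top_iff.2 fun M => ?_
  refine (limsup_coe_eq_top_iff.1 hx (M + ∑ j ∈ Finset.range k, |x j - y j|)).mono fun n hn => ?_
  have := (abs_le.1 (abs_seqCentre_sub_le_of_eq_of_ge h n)).2
  linarith

theorem seqLimsup_eq_bot_of_eventually_eq {x y : ℕ → ℝ} {k : ℕ} (h : ∀ i, k ≤ i → x i = y i)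
    (hx : seqLimsup x = ⊥) : seqLimsup y = ⊥ := by
  refine limsup_coe_eq_bot_iff.2 (tendsto_atBot.2 fun M => ?_)
  refine (tendsto_atBot.1 (limsup_coe_eq_bot_iff.1 hx)
    (M - ∑ j ∈ Finset.range k, |x j - y j|)).mono fun n hn => ?_
  have := (abs_le.1 (abs_seqCentre_sub_le_of_eq_of_ge h n)).1
  linarith

/-! ### Characteristic functions -/

theorem ae_eq_zero_of_charFun_eventually_eq_one {μ : Measure ℝ} [IsProbabilityMeasure μ]
    (h : ∀ᶠ t in 𝓝 0, charFun μ t = 1) : ∀ᵐ x ∂μ, x = 0 := by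
  obtain ⟨δ, hδ, hball⟩ := Metric.eventually_nhds_iff.1 h
  have hcos : ∀ t : ℝ, charFun μ t = 1 → ∀ᵐ x ∂μ, Real.cos (t * x) = 1 := by
    intro t ht
    have hint : Integrable (fun x : ℝ => Complex.exp (t * x * Complex.I)) μ := by
      refine Integrable.of_bound (by fun_prop) 1 (Eventually.of_forall fun x => ?_)
      rw [← Complex.ofReal_mul, Complex.norm_exp_ofReal_mul_I]
    have hre : ∫ x, Real.cos (t * x) ∂μ = 1 := by
      rw [charFun_apply_real] at ht
      have := congrArg Complex.re ht
      rw [← RCLike.re_eq_complex_re, ← integral_re hint] at this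
      simpa [← Complex.ofReal_mul, Complex.exp_ofReal_mul_I_re] using this
    have hcint : Integrable (fun x : ℝ => Real.cos (t * x)) μ :=
      Integrable.of_bound (by fun_prop) 1 (Eventually.of_forall fun x => Real.abs_cos_le_one _)
    have hzero : ∫ x, (1 - Real.cos (t * x)) ∂μ = 0 := by
      rw [integral_sub (integrable_const _) hcint, hre]; simp
    rw [integral_eq_zero_iff_of_nonneg (fun x => sub_nonneg.2 (Real.cos_le_one _))
      ((integrable_const _).sub hcint)] at hzero
    filter_upwards [hzero] with x hx
    simp only [Pi.zero_apply] at hx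
    linarith
  -- Countably many frequencies keep the exceptional set null; `m + 2` makes each strictly less than
  -- `δ`.
  have hall : ∀ᵐ x ∂μ, ∀ m : ℕ, Real.cos (δ / (m + 2) * x) = 1 := by
    rw [ae_all_iff]
    intro m
    refine hcos _ (hball ?_)
    rw [dist_zero_right, Real.norm_eq_abs, abs_of_pos (by positivity), div_lt_iff₀ (by positivity)]
    nlinarith [(Nat.cast_nonneg m : (0 : ℝ) ≤ m)]
  filter_upwards [hall] with x hx
  obtain ⟨m, hm⟩ := exists_nat_gt (δ * |x|)
  have hsmall : |δ / (m + 2) * x| < 1 := by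
    rw [abs_mul, abs_of_pos (by positivity), div_mul_eq_mul_div, div_lt_one (by positivity)]
    linarith
  have hpi := Real.pi_gt_three
  obtain ⟨h1, h2⟩ := abs_lt.1 hsmall
  have := (Real.cos_eq_one_iff_of_lt_of_lt (by linarith) (by linarith)).1 (hx m)
  have hne : δ / ((m : ℝ) + 2) ≠ 0 := by positivity
  simpa [hne] using this

/-- If `Z` has the same law as `Y + Z` with `Y` independent of `Z`, then `Y` vanishes. -/
theorem ae_eq_zero_of_map_eq_map_add {Ω : Type*} [MeasurableSpace Ω] {P : Measure Ω}
    [IsProbabilityMeasure P] {Y Z Z' : Ω → ℝ} (hY : Measurable Y) (hZ : Measurable Z)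
    (hindep : IndepFun Y Z P) (hlaw : IdentDistrib Z' Z P P)
    (hadd : ∀ᵐ ω ∂P, Z' ω = Y ω + Z ω) : ∀ᵐ ω ∂P, Y ω = 0 := by
  have : IsProbabilityMeasure (P.map Y) := Measure.isProbabilityMeasure_map hY.aemeasurable
  have : IsProbabilityMeasure (P.map Z) := Measure.isProbabilityMeasure_map hZ.aemeasurable
  have hchar : charFun (P.map Z) = charFun (P.map Y) * charFun (P.map Z) := by
    rw [← hindep.charFun_map_fun_add_eq_mul hY.aemeasurable hZ.aemeasurable, ← hlaw.map_eq]
    exact congrArg _ (Measure.map_congr hadd)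
  -- Near `0` the factor `charFun (P.map Z)` is nonzero and can be cancelled.
  have hne : ∀ᶠ t in 𝓝 (0 : ℝ), charFun (P.map Z) t ≠ 0 :=
    (continuous_charFun (μ := P.map Z)).continuousAt.eventually_ne (by simp)
  refine ae_of_ae_map hY.aemeasurable (ae_eq_zero_of_charFun_eventually_eq_one ?_)
  filter_upwards [hne] with t ht
  have h2 : charFun (P.map Z) t = charFun (P.map Y) t * charFun (P.map Z) t := congrFun hchar t
  exact (mul_eq_right₀ ht).1 h2.symm

theorem measurable_of_forall_eval {Ω : Type*} {m : MeasurableSpace Ω} {f : Ω → ℕ → ℝ}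
    (hf : ∀ i, Measurable fun ω => f ω i) : Measurable f :=
  measurable_pi_lambda f hf

/-! ### Zero-one law, dichotomy and the symmetric case -/

section Independent

variable {Ω : Type*} [MeasurableSpace Ω] {P : Measure Ω} {X : ℕ → Ω → ℝ}

theorem identDistrib_shift (hindep : iIndepFun X P) (hident : ∀ i, IdentDistrib (X i) (X 0) P P)
    (k : ℕ) : IdentDistrib (fun ω i => X (k + i) ω) (fun ω i => X i ω) P P :=
  IdentDistrib.pi (fun i => (hident (k + i)).trans (hident i).symm)
    (hindep.precomp (add_right_injective k)) hindep

theorem ae_tendsto_average (hindep : iIndepFun X P) (hident : ∀ i, IdentDistrib (X i) (X 0) P P)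
    (hint : Integrable (X 0) P) (hmean : ∫ ω, X 0 ω ∂P = 0) :
    ∀ᵐ ω ∂P, Tendsto (fun n : ℕ => (∑ i ∈ Finset.range n, X i ω) / n) atTop (𝓝 0) := by
  have := strong_law_ae_real X hint (fun i j hij => hindep.indepFun hij) hident
  rwa [hmean] at this

theorem indepFun_zero_shift (hmeas : ∀ i, Measurable (X i)) (hindep : iIndepFun X P) :
    IndepFun (X 0) (fun ω i => X (i + 1) ω) P := by
  have h := indep_iSup_of_disjoint (fun i => (hmeas i).comap_le) hindep
    (S := {0}) (T := {i | 1 ≤ i}) (by simp)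
  refine indep_of_indep_of_le_left (indep_of_indep_of_le_right h ?_) ?_
  · refine Measurable.comap_le (measurable_of_forall_eval fun i => ?_)
    exact (comap_measurable (X (i + 1))).mono
      (le_iSup₂_of_le (f := fun i (_ : i ∈ {i : ℕ | 1 ≤ i}) =>
        MeasurableSpace.comap (X i) inferInstance) (i + 1) (by simp) le_rfl) le_rfl
  · exact le_iSup₂_of_le (f := fun i (_ : i ∈ ({0} : Set ℕ)) =>
        MeasurableSpace.comap (X i) inferInstance) 0 rfl le_rfl

variable [IsProbabilityMeasure P]

theorem ae_or_ae_not_of_tail (hmeas : ∀ i, Measurable (X i)) (hindep : iIndepFun X P)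
    {A : Set (ℕ → ℝ)} (hA : MeasurableSet A)
    (htail : ∀ (k : ℕ) (x y : ℕ → ℝ), (∀ i, k ≤ i → x i = y i) → x ∈ A → y ∈ A) :
    (∀ᵐ ω ∂P, (fun i => X i ω) ∈ A) ∨ ∀ᵐ ω ∂P, (fun i => X i ω) ∉ A := by
  let s : ℕ → MeasurableSpace Ω := fun i => MeasurableSpace.comap (X i) inferInstance
  have hT : MeasurableSet[limsup s atTop] {ω | (fun i => X i ω) ∈ A} := by
    rw [limsup_eq_iInf_iSup_of_nat]
    rw [MeasurableSpace.measurableSet_iInf]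
    intro k
    -- By tail invariance the first `k` coordinates may be set to `0`, so the event depends only on
    -- `X i` with `k ≤ i`.
    have heq : {ω | (fun i => X i ω) ∈ A} =
        (fun ω (i : ℕ) => if k ≤ i then X i ω else 0) ⁻¹' A := by
      ext ω
      exact ⟨htail k _ _ fun i hi => by simp [hi], htail k _ _ fun i hi => by simp [hi]⟩
    rw [heq]
    refine (measurable_of_forall_eval fun i => ?_) hA
    by_cases hi : k ≤ i
    · simp only [hi, if_true]
      exact (comap_measurable (X i)).mono
        (le_iSup₂_of_le (f := fun i (_ : i ≥ k) => s i) i hi le_rfl) le_rfl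
    · simp only [hi, if_false]
      exact measurable_const
  have hset : MeasurableSet {ω | (fun i => X i ω) ∈ A} := measurable_pi_lambda _ hmeas hA
  rcases measure_zero_or_one_of_measurableSet_limsup_atTop
    (fun i => (hmeas i).comap_le) hindep hT with h | h
  · exact Or.inr (measure_eq_zero_iff_ae_notMem.1 h)
  · exact Or.inl ((prob_compl_eq_zero_iff hset).2 h)

/-- The upper limit of the centre of mass is almost surely infinite, of a deterministic sign. -/
theorem seqLimsup_ae_eq_top_or_bot (hmeas : ∀ i, Measurable (X i)) (hindep : iIndepFun X P)
    (hident : ∀ i, IdentDistrib (X i) (X 0) P P) (hint : Integrable (X 0) P)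
    (hmean : ∫ ω, X 0 ω ∂P = 0) (hne : ¬ ∀ᵐ ω ∂P, X 0 ω = 0) :
    (∀ᵐ ω ∂P, seqLimsup (fun i => X i ω) = ⊤) ∨ ∀ᵐ ω ∂P, seqLimsup (fun i => X i ω) = ⊥ := by
  have htop : (∀ᵐ ω ∂P, seqLimsup (fun i => X i ω) = ⊤) ∨
      ∀ᵐ ω ∂P, ¬ seqLimsup (fun i => X i ω) = ⊤ :=
    ae_or_ae_not_of_tail hmeas hindep (A := {x | seqLimsup x = ⊤})
      (measurable_seqLimsup (measurableSet_singleton ⊤))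
      fun k x y h => seqLimsup_eq_top_of_eventually_eq h
  have hbot : (∀ᵐ ω ∂P, seqLimsup (fun i => X i ω) = ⊥) ∨
      ∀ᵐ ω ∂P, ¬ seqLimsup (fun i => X i ω) = ⊥ :=
    ae_or_ae_not_of_tail hmeas hindep (A := {x | seqLimsup x = ⊥})
      (measurable_seqLimsup (measurableSet_singleton ⊥))
      fun k x y h => seqLimsup_eq_bot_of_eventually_eq h
  rcases htop with htop | htop
  · exact Or.inl htop
  rcases hbot with hbot | hbot
  · exact Or.inr hbot
  -- Now the upper limit is a.s. finite, so `toReal` respects its decomposition into first step and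
  -- remainder.
  refine absurd ?_ hne
  have hmeasL : Measurable fun x : ℕ → ℝ => (seqLimsup x).toReal :=
    measurable_seqLimsup.ereal_toReal
  have hshift : IdentDistrib (fun ω i => X (i + 1) ω) (fun ω i => X i ω) P P := by
    simpa only [add_comm] using identDistrib_shift hindep hident 1
  have htopS : ∀ᵐ ω ∂P, ¬ seqLimsup (fun i => X (i + 1) ω) = ⊤ :=
    hshift.symm.ae_snd (p := fun x => ¬ seqLimsup x = ⊤)
      (measurable_seqLimsup (measurableSet_singleton ⊤)).compl htop
  have hbotS : ∀ᵐ ω ∂P, ¬ seqLimsup (fun i => X (i + 1) ω) = ⊥ :=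
    hshift.symm.ae_snd (p := fun x => ¬ seqLimsup x = ⊥)
      (measurable_seqLimsup (measurableSet_singleton ⊥)).compl hbot
  have hslln : ∀ᵐ ω ∂P,
      Tendsto (fun n : ℕ => (∑ i ∈ Finset.range n, X (i + 1) ω) / n) atTop (𝓝 0) :=
    ae_tendsto_average (X := fun i => X (i + 1)) (hindep.precomp (add_left_injective 1))
      (fun i => (hident (i + 1)).trans (hident 1).symm) ((hident 1).integrable_iff.2 hint)
      ((hident 1).integral_eq.trans hmean)
  have hindepL : IndepFun (X 0) (fun ω => (seqLimsup fun i => X (i + 1) ω).toReal) P :=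
    (indepFun_zero_shift hmeas hindep).comp measurable_id hmeasL
  have hlawL : IdentDistrib (fun ω => (seqLimsup fun i => X i ω).toReal)
      (fun ω => (seqLimsup fun i => X (i + 1) ω).toReal) P P := hshift.symm.comp hmeasL
  have hmeasS : Measurable fun ω => (seqLimsup fun i => X (i + 1) ω).toReal :=
    hmeasL.comp (measurable_pi_lambda _ fun i => hmeas (i + 1))
  refine ae_eq_zero_of_map_eq_map_add (hmeas 0) hmeasS hindepL hlawL ?_
  filter_upwards [htopS, hbotS, hslln] with ω h1 h2 h3
  have h4 := seqLimsup_eq_add_head (x := fun i => X i ω) h3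
  rw [h4, EReal.toReal_add h1 h2 (EReal.coe_ne_top _) (EReal.coe_ne_bot _), EReal.toReal_coe,
    add_comm]

theorem not_ae_seqLimsup_eq_bot_of_symmetric (hindep : iIndepFun X P)
    (hident : ∀ i, IdentDistrib (X i) (X 0) P P)
    (hsymm : IdentDistrib (X 0) (fun ω => -X 0 ω) P P) :
    ¬ ∀ᵐ ω ∂P, seqLimsup (fun i => X i ω) = ⊥ := by
  intro h
  have hneg : IdentDistrib (fun ω i => X i ω) (fun ω i => -X i ω) P P :=
    IdentDistrib.pi (fun i => ((hident i).trans hsymm).trans ((hident i).symm.comp measurable_neg))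
      hindep (hindep.comp (fun _ x => -x) fun _ => measurable_neg)
  have h' := hneg.ae_snd (p := fun x => seqLimsup x = ⊥)
    (measurable_seqLimsup (measurableSet_singleton ⊥)) h
  obtain ⟨ω, h1, h2⟩ := (h.and h').exists
  have h1 := limsup_coe_eq_bot_iff.1 h1
  have h2 := limsup_coe_eq_bot_iff.1 h2
  have h3 : seqCentre (fun i => -X i ω) = fun n => -seqCentre (fun i => X i ω) n :=
    funext fun n => seqCentre_neg _ n
  rw [h3, tendsto_neg_atBot_iff] at h2
  exact h1.not_tendsto disjoint_atBot_atTop h2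

end Independent

/-! ### The square integrable case -/

/-- A centred random variable that is rarely positive is small in `L¹`, relative to `L²`. -/
theorem integral_abs_le_of_integral_eq_zero {Ω : Type*} [MeasurableSpace Ω] {P : Measure Ω}
    [IsProbabilityMeasure P] {Y : Ω → ℝ} (hY : Measurable Y) (hmem : MemLp Y 2 P)
    (hmean : ∫ ω, Y ω ∂P = 0) {ε : ℝ} (hε : 0 < ε) :
    ∫ ω, |Y ω| ∂P ≤ 2 * ε * ∫ ω, Y ω ^ 2 ∂P + P.real {ω | 0 < Y ω} / (2 * ε) := by
  have hint : Integrable Y P := hmem.integrable one_le_two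
  have hset : MeasurableSet {ω | 0 < Y ω} := measurableSet_lt measurable_const hY
  have hind : Integrable ({ω | 0 < Y ω}.indicator fun _ => (2 * ε)⁻¹) P :=
    (integrable_const _).indicator hset
  have hsq : Integrable (fun ω => 2 * ε * Y ω ^ 2) P := hmem.integrable_sq.const_mul _
  calc ∫ ω, |Y ω| ∂P
      ≤ ∫ ω, ((-Y ω + 2 * ε * Y ω ^ 2) + {ω | 0 < Y ω}.indicator (fun _ => (2 * ε)⁻¹) ω) ∂P := by
        -- Pointwise `|Y| = -Y + 2Y⁺`, and `2Y ≤ 2εY² + 1/(2ε)` where `Y > 0`.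
        refine integral_mono hint.abs ((hint.neg.add hsq).add hind) fun ω => ?_
        by_cases h : 0 < Y ω
        · have h1 : {ω | 0 < Y ω}.indicator (fun _ => (2 * ε)⁻¹) ω = (2 * ε)⁻¹ :=
            Set.indicator_of_mem (s := {ω | 0 < Y ω}) h _
          have h2 : 2 * ε * Y ω ^ 2 + (2 * ε)⁻¹ - 2 * Y ω = (2 * ε)⁻¹ * (2 * ε * Y ω - 1) ^ 2 := by
            field_simp
            ring
          have h3 : 0 ≤ (2 * ε)⁻¹ * (2 * ε * Y ω - 1) ^ 2 := by positivity
          simp only [h1, abs_of_pos h]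
          linarith
        · have h1 : {ω | 0 < Y ω}.indicator (fun _ => (2 * ε)⁻¹) ω = 0 :=
            Set.indicator_of_notMem (s := {ω | 0 < Y ω}) h _
          simp only [h1, abs_of_nonpos (not_lt.1 h)]
          have : 0 ≤ 2 * ε * Y ω ^ 2 := by positivity
          linarith
    _ = 2 * ε * ∫ ω, Y ω ^ 2 ∂P + P.real {ω | 0 < Y ω} / (2 * ε) := by
        have h1 : Integrable (fun ω => -Y ω) P := hint.neg
        have h2 : Integrable (fun ω => -Y ω + 2 * ε * Y ω ^ 2) P := h1.add hsq
        rw [integral_add h2 hind, integral_add h1 hsq, integral_neg, hmean,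
          integral_const_mul, integral_indicator_const _ hset]
        simp [div_eq_mul_inv]

theorem tendsto_measureReal_pos_of_ae_tendsto_atBot {Ω : Type*} [MeasurableSpace Ω] {P : Measure Ω}
    [IsProbabilityMeasure P] {Y : ℕ → Ω → ℝ} (hY : ∀ n, Measurable (Y n))
    (h : ∀ᵐ ω ∂P, Tendsto (fun n => Y n ω) atTop atBot) :
    Tendsto (fun n => P.real {ω | 0 < Y n ω}) atTop (𝓝 0) := by
  have hset : ∀ n, MeasurableSet {ω | 0 < Y n ω} := fun n => measurableSet_lt measurable_const (hY n)
  have key : Tendsto (fun n => ∫ ω, {ω | 0 < Y n ω}.indicator (fun _ => (1 : ℝ)) ω ∂P) atTop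
      (𝓝 (∫ _, (0 : ℝ) ∂P)) := by
    refine tendsto_integral_of_dominated_convergence (fun _ => 1)
      (fun n => (measurable_const.indicator (hset n)).aestronglyMeasurable) (integrable_const _)
      (fun n => Eventually.of_forall fun ω => ?_) ?_
    · refine (norm_indicator_le_norm_self _ _).trans (by simp)
    · filter_upwards [h] with ω hω
      refine tendsto_const_nhds.congr' ?_
      filter_upwards [tendsto_atBot.1 hω 0] with n hn
      exact (Set.indicator_of_notMem (s := {ω | 0 < Y n ω}) (not_lt.2 hn) _).symm
  simpa [integral_indicator_const _ (hset _)] using key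

theorem seqCentre_eq_sum_fun {Ω : Type*} (X : ℕ → Ω → ℝ) (n : ℕ) :
    (fun ω => seqCentre (fun i => X i ω) n) =
      ∑ i ∈ Finset.range n, fun ω => ((n : ℝ)⁻¹ * ((n : ℝ) - i)) * X i ω := by
  ext ω
  simp [seqCentre_eq, Finset.mul_sum, mul_assoc]

section SquareIntegrable

variable {Ω : Type*} [MeasurableSpace Ω] {P : Measure Ω} {X : ℕ → Ω → ℝ}

theorem memLp_seqCentre (hident : ∀ i, IdentDistrib (X i) (X 0) P P) (hmem : MemLp (X 0) 2 P)
    (n : ℕ) : MemLp (fun ω => seqCentre (fun i => X i ω) n) 2 P := by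
  rw [seqCentre_eq_sum_fun]
  exact memLp_finsetSum' _ fun i _ => ((hident i).memLp_iff.2 hmem).const_mul _

theorem integral_seqCentre_eq_zero (hident : ∀ i, IdentDistrib (X i) (X 0) P P)
    (hint : Integrable (X 0) P) (hmean : ∫ ω, X 0 ω ∂P = 0) (n : ℕ) :
    ∫ ω, seqCentre (fun i => X i ω) n ∂P = 0 := by
  simp only [seqCentre_eq]
  rw [integral_const_mul, integral_finsetSum _ fun i _ =>
    ((hident i).integrable_iff.2 hint).const_mul _]
  simp [integral_const_mul, (hident _).integral_eq, hmean]

variable [IsProbabilityMeasure P]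

theorem integral_seqCentre_sq_le (hindep : iIndepFun X P)
    (hident : ∀ i, IdentDistrib (X i) (X 0) P P) (hmem : MemLp (X 0) 2 P)
    (hmean : ∫ ω, X 0 ω ∂P = 0) (n : ℕ) :
    ∫ ω, seqCentre (fun i => X i ω) n ^ 2 ∂P ≤ n * variance (X 0) P := by
  have hG := memLp_seqCentre hident hmem n
  rw [← variance_of_integral_eq_zero hG.aestronglyMeasurable.aemeasurable
    (integral_seqCentre_eq_zero hident (hmem.integrable one_le_two) hmean n),
    seqCentre_eq_sum_fun, IndepFun.variance_sum]
  · have hterm : ∀ i ∈ Finset.range n,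
        variance (fun ω => ((n : ℝ)⁻¹ * ((n : ℝ) - i)) * X i ω) P ≤ variance (X 0) P := by
      intro i hi
      have hi' : (i : ℝ) < n := by exact_mod_cast Finset.mem_range.1 hi
      have hi0 : (0 : ℝ) ≤ i := Nat.cast_nonneg i
      rw [variance_const_mul, (hident i).variance_eq]
      refine mul_le_of_le_one_left (variance_nonneg _ _) ?_
      have h0 : 0 ≤ (n : ℝ)⁻¹ * ((n : ℝ) - i) :=
        mul_nonneg (by positivity) (by linarith)
      refine pow_le_one₀ h0 ?_
      rw [inv_mul_le_iff₀ (by linarith)]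
      linarith
    simpa using Finset.sum_le_card_nsmul _ _ _ hterm
  · exact fun i _ => ((hident i).memLp_iff.2 hmem).const_mul _
  · intro i _ j _ hij
    exact (hindep.indepFun hij).comp (measurable_const_mul _) (measurable_const_mul _)

theorem tendsto_integral_abs_seqCentre_div_sqrt (hmeas : ∀ i, Measurable (X i))
    (hindep : iIndepFun X P) (hident : ∀ i, IdentDistrib (X i) (X 0) P P)
    (hmem : MemLp (X 0) 2 P) (hmean : ∫ ω, X 0 ω ∂P = 0)
    (hbot : ∀ᵐ ω ∂P, Tendsto (fun n => seqCentre (fun i => X i ω) n) atTop atBot) :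
    Tendsto (fun n : ℕ => (∫ ω, |seqCentre (fun i => X i ω) n| ∂P) / √n) atTop (𝓝 0) := by
  have hGmeas : ∀ n, Measurable fun ω => seqCentre (fun i => X i ω) n := fun n =>
    (measurable_seqCentre n).comp (measurable_pi_lambda _ hmeas)
  have hp := tendsto_measureReal_pos_of_ae_tendsto_atBot hGmeas hbot
  set p : ℕ → ℝ := fun n => P.real {ω | 0 < seqCentre (fun i => X i ω) n}
  set v := variance (X 0) P
  have hv : 0 ≤ v := variance_nonneg _ _
  have hbound : ∀ δ : ℝ, 0 < δ → ∀ n : ℕ, n ≠ 0 →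
      (∫ ω, |seqCentre (fun i => X i ω) n| ∂P) / √n ≤ 2 * δ * v + p n / (2 * δ) := by
    intro δ hδ n hn
    have hs : 0 < √(n : ℝ) := Real.sqrt_pos.2 (by positivity)
    have h1 := integral_abs_le_of_integral_eq_zero (hGmeas n) (memLp_seqCentre hident hmem n)
      (integral_seqCentre_eq_zero hident (hmem.integrable one_le_two) hmean n)
      -- This scaling balances `E G_n² = O(n)`, leaving a bound in which only `p n` depends on `n`.
      (ε := δ / √n) (by positivity)
    have h2 := integral_seqCentre_sq_le hindep hident hmem hmean n
    rw [div_le_iff₀ hs]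
    calc _ ≤ _ := h1
      _ ≤ 2 * (δ / √n) * (n * v) + p n / (2 * (δ / √n)) := by gcongr
      _ = (2 * δ * v + p n / (2 * δ)) * √n := by
        have hn' : (n : ℝ) = √n * √n := (Real.mul_self_sqrt (by positivity)).symm
        generalize √(n : ℝ) = r at *
        rw [hn']
        field_simp
  refine tendsto_order.2 ⟨fun a ha => Eventually.of_forall fun n => ha.trans_le ?_, fun a ha => ?_⟩
  · exact div_nonneg (integral_nonneg fun _ => abs_nonneg _) (Real.sqrt_nonneg _)
  -- This `δ` gives `2 * δ * v < a / 2`; the `+ 1` avoids division by zero.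
  · have hδ : 0 < a / (4 * (v + 1)) := by positivity
    set δ := a / (4 * (v + 1)) with hδdef
    have hlim : Tendsto (fun n => 2 * δ * v + p n / (2 * δ)) atTop (𝓝 (2 * δ * v + 0 / (2 * δ))) :=
      tendsto_const_nhds.add (hp.div_const _)
    have hlt : 2 * δ * v + 0 / (2 * δ) < a := by
      have h4 : δ * (4 * (v + 1)) = a := by rw [hδdef]; field_simp
      rw [zero_div, add_zero]
      nlinarith
    filter_upwards [hlim.eventually_lt_const hlt, eventually_ne_atTop 0] with n h1 hn
    exact (hbound δ hδ n hn).trans_lt h1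

/-- By `sum_range_eq_seqCentre`, `S_n` is a combination of `G_{2n}`, `G_n` and an independent-block
copy of `G_n` with the same law. -/
theorem tendsto_integral_abs_walk_div_sqrt (hindep : iIndepFun X P)
    (hident : ∀ i, IdentDistrib (X i) (X 0) P P)
    (hmem : MemLp (X 0) 2 P)
    (hG : Tendsto (fun n : ℕ => (∫ ω, |seqCentre (fun i => X i ω) n| ∂P) / √n) atTop (𝓝 0)) :
    Tendsto (fun n : ℕ => (∫ ω, |∑ i ∈ Finset.range n, X i ω| ∂P) / √n) atTop (𝓝 0) := by
  have hint : ∀ n, Integrable (fun ω => |seqCentre (fun i => X i ω) n|) P := fun n =>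
    ((memLp_seqCentre hident hmem n).integrable one_le_two).abs
  have habs : ∀ n, Measurable fun x : ℕ → ℝ => |seqCentre x n| := fun n =>
    (measurable_seqCentre n).abs
  have hdouble : Tendsto (fun n : ℕ => n + n) atTop atTop :=
    tendsto_atTop_mono (fun n => Nat.le_add_left n n) tendsto_id
  have hlim := ((hG.comp hdouble).const_mul (2 * √2)).add (hG.const_mul 2)
  simp only [mul_zero, add_zero] at hlim
  refine squeeze_zero' (Eventually.of_forall fun n =>
    div_nonneg (integral_nonneg fun _ => abs_nonneg _) (Real.sqrt_nonneg _)) ?_ hlim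
  filter_upwards [eventually_ne_atTop 0] with n hn
  have hshift : IdentDistrib (fun ω => |seqCentre (fun i => X (n + i) ω) n|)
      (fun ω => |seqCentre (fun i => X i ω) n|) P P :=
    (identDistrib_shift hindep hident n).comp (habs n)
  have hintS := hshift.integrable_iff.2 (hint n)
  have hs : 0 < √(n : ℝ) := Real.sqrt_pos.2 (by positivity)
  have hs2 : √((n + n : ℕ) : ℝ) = √2 * √n := by
    rw [← Real.sqrt_mul (by norm_num)]; push_cast; ring_nf
  have hle : ∫ ω, |∑ i ∈ Finset.range n, X i ω| ∂P ≤
      2 * ∫ ω, |seqCentre (fun i => X i ω) (n + n)| ∂P +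
        2 * ∫ ω, |seqCentre (fun i => X i ω) n| ∂P := by
    calc ∫ ω, |∑ i ∈ Finset.range n, X i ω| ∂P
        ≤ ∫ ω, ((2 * |seqCentre (fun i => X i ω) (n + n)| + |seqCentre (fun i => X i ω) n|) +
            |seqCentre (fun i => X (n + i) ω) n|) ∂P := by
          refine integral_mono_of_nonneg (Eventually.of_forall fun _ => abs_nonneg _)
            ((((hint _).const_mul 2).add (hint n)).add hintS) (Eventually.of_forall fun ω => ?_)
          have h := sum_range_eq_seqCentre (fun i => X i ω) hn
          simp only [h]
          refine (abs_sub _ _).trans (add_le_add_left ((abs_sub _ _).trans ?_) _)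
          rw [abs_mul, abs_two]
      _ = _ := by
          have h1 : Integrable (fun ω => 2 * |seqCentre (fun i => X i ω) (n + n)|) P :=
            (hint _).const_mul 2
          have h2 : Integrable (fun ω => 2 * |seqCentre (fun i => X i ω) (n + n)| +
              |seqCentre (fun i => X i ω) n|) P := h1.add (hint n)
          rw [integral_add h2 hintS, integral_add h1 (hint n), integral_const_mul, hshift.integral_eq]
          ring
  simp only [Function.comp_apply, hs2]
  calc _ ≤ (2 * ∫ ω, |seqCentre (fun i => X i ω) (n + n)| ∂P +
        2 * ∫ ω, |seqCentre (fun i => X i ω) n| ∂P) / √n := by gcongr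
    _ = _ := by field_simp

/-- Convergence in `L¹` would make the limit law of `S_n / √n` a point mass at `0`, but that law is
a nondegenerate Gaussian, which has no atoms. -/
theorem not_tendsto_integral_abs_walk_div_sqrt (hmeas : ∀ i, Measurable (X i))
    (hindep : iIndepFun X P) (hident : ∀ i, IdentDistrib (X i) (X 0) P P)
    (hmem : MemLp (X 0) 2 P) (hvar : 0 < variance (X 0) P) (hmean : ∫ ω, X 0 ω ∂P = 0) :
    ¬ Tendsto (fun n : ℕ => (∫ ω, |∑ i ∈ Finset.range n, X i ω| ∂P) / √n) atTop (𝓝 0) := by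
  intro h
  have hclt := tendstoInDistribution_inv_sqrt_mul_sum_sub
    (Y := id) (P' := gaussianReal 0 (variance (X 0) P).toNNReal) HasLaw.id hmem hindep hident
  simp only [hmean, mul_zero, sub_zero] at hclt
  have hm : ∀ n : ℕ, Measurable fun ω => (√(n : ℝ))⁻¹ * ∑ i ∈ Finset.range n, X i ω := fun n =>
    (Finset.measurable_fun_sum _ fun i _ => hmeas i).const_mul _
  have hprob : TendstoInMeasure P
      (fun (n : ℕ) ω => (√(n : ℝ))⁻¹ * ∑ i ∈ Finset.range n, X i ω) atTop fun _ => (0 : ℝ) := by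
    refine tendstoInMeasure_of_tendsto_eLpNorm (p := 1) one_ne_zero
      (fun n => (hm n).aestronglyMeasurable) aestronglyMeasurable_const ?_
    have hnorm : ∀ n : ℕ, eLpNorm ((fun ω => (√(n : ℝ))⁻¹ * ∑ i ∈ Finset.range n, X i ω) -
        fun _ => (0 : ℝ)) 1 P =
        ENNReal.ofReal ((∫ ω, |∑ i ∈ Finset.range n, X i ω| ∂P) / √n) := by
      intro n
      have hi : Integrable (fun ω => (√(n : ℝ))⁻¹ * ∑ i ∈ Finset.range n, X i ω) P :=
        (integrable_finsetSum _ fun i _ =>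
          (hident i).integrable_iff.2 (hmem.integrable one_le_two)).const_mul _
      rw [show ((fun ω => (√(n : ℝ))⁻¹ * ∑ i ∈ Finset.range n, X i ω) - fun _ => (0 : ℝ)) =
        fun ω => (√(n : ℝ))⁻¹ * ∑ i ∈ Finset.range n, X i ω by ext; simp,
        eLpNorm_one_eq_lintegral_enorm, ← ofReal_integral_norm_eq_lintegral_enorm hi]
      congr 1
      simp only [norm_mul, norm_inv, Real.norm_eq_abs, abs_of_nonneg (Real.sqrt_nonneg _)]
      rw [integral_const_mul, div_eq_inv_mul]
    simp only [hnorm]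
    simpa using ENNReal.tendsto_ofReal h
  have hlaw := tendstoInDistribution_unique _ hclt
    (hprob.tendstoInDistribution fun n => (hm n).aemeasurable)
  have : NullSingletonClass (gaussianReal 0 (variance (X 0) P).toNNReal) :=
    nullSingletonClass_gaussianReal (by simpa using hvar)
  have h0 := congrArg (fun μ : Measure ℝ => μ {0}) hlaw
  simp [measure_singleton] at h0

theorem not_ae_seqLimsup_eq_bot_of_memLp_two (hmeas : ∀ i, Measurable (X i))
    (hindep : iIndepFun X P) (hident : ∀ i, IdentDistrib (X i) (X 0) P P)
    (hmem : MemLp (X 0) 2 P) (hvar : 0 < variance (X 0) P) (hmean : ∫ ω, X 0 ω ∂P = 0) :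
    ¬ ∀ᵐ ω ∂P, seqLimsup (fun i => X i ω) = ⊥ := fun h =>
  not_tendsto_integral_abs_walk_div_sqrt hmeas hindep hident hmem hvar hmean
    (tendsto_integral_abs_walk_div_sqrt hindep hident hmem
      (tendsto_integral_abs_seqCentre_div_sqrt hmeas hindep hident hmem hmean
        (h.mono fun _ hω => limsup_coe_eq_bot_iff.1 hω)))

end SquareIntegrable

/-! ### Both hypotheses together, and the conclusion -/

/-- The step distribution is nondegenerate, and either symmetric and integrable, or centred and
square integrable. -/
def IsAdmissibleStep {Ω : Type*} [MeasurableSpace Ω] (P : Measure Ω) (Y : Ω → ℝ) : Prop :=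
  (Integrable Y P ∧ 0 < ∫ ω, |Y ω| ∂P ∧ IdentDistrib Y (fun ω => -Y ω) P P) ∨
    (MemLp Y 2 P ∧ 0 < variance Y P ∧ ∫ ω, Y ω ∂P = 0)

namespace IsAdmissibleStep

variable {Ω : Type*} [MeasurableSpace Ω] {P : Measure Ω} {Y : Ω → ℝ}

theorem neg (h : IsAdmissibleStep P Y) : IsAdmissibleStep P fun ω => -Y ω := by
  rcases h with ⟨h1, h2, h3⟩ | ⟨h1, h2, h3⟩
  · exact Or.inl ⟨h1.neg, by simpa using h2, h3.comp measurable_neg⟩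
  · refine Or.inr ⟨h1.neg, ?_, by rw [integral_neg, h3, neg_zero]⟩
    have := variance_neg (X := Y) (μ := P)
    simpa [Pi.neg_def] using this.symm ▸ h2

theorem integral_eq_zero (h : IsAdmissibleStep P Y) : ∫ ω, Y ω ∂P = 0 := by
  rcases h with ⟨-, -, h3⟩ | ⟨-, -, h3⟩
  · have := h3.integral_eq
    rw [integral_neg] at this
    linarith
  · exact h3

theorem not_ae_eq_zero (h : IsAdmissibleStep P Y) : ¬ ∀ᵐ ω ∂P, Y ω = 0 := by
  intro h0
  have h0' : Y =ᵐ[P] 0 := h0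
  rcases h with ⟨-, h2, -⟩ | ⟨-, h2, -⟩
  · rw [integral_congr_ae (g := fun _ => (0 : ℝ)) (h0.mono fun ω hω => by simp [hω])] at h2
    simp at h2
  · rw [variance_congr h0'] at h2
    simp at h2

variable [IsProbabilityMeasure P]

theorem integrable (h : IsAdmissibleStep P Y) : Integrable Y P := by
  rcases h with ⟨h1, -, -⟩ | ⟨h1, -, -⟩
  · exact h1
  · exact h1.integrable one_le_two

theorem ae_seqLimsup_eq_top {X : ℕ → Ω → ℝ} (h : IsAdmissibleStep P (X 0))
    (hmeas : ∀ i, Measurable (X i)) (hindep : iIndepFun X P)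
    (hident : ∀ i, IdentDistrib (X i) (X 0) P P) :
    ∀ᵐ ω ∂P, seqLimsup (fun i => X i ω) = ⊤ := by
  refine (seqLimsup_ae_eq_top_or_bot hmeas hindep hident h.integrable h.integral_eq_zero
    h.not_ae_eq_zero).resolve_right ?_
  rcases h with ⟨-, -, h3⟩ | ⟨h1, h2, h3⟩
  · exact not_ae_seqLimsup_eq_bot_of_symmetric hindep hident h3
  · exact not_ae_seqLimsup_eq_bot_of_memLp_two hmeas hindep hident h1 h2 h3

end IsAdmissibleStep

theorem theorem1p4 {Ω : Type*} [MeasurableSpace Ω] (P : Measure Ω) [IsProbabilityMeasure P]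
    (X : ℕ → Ω → ℝ) (hmeas : ∀ i, Measurable (X i)) (hindep : iIndepFun X P)
    (hident : ∀ i, IdentDistrib (X i) (X 0) P P)
    (h : (Integrable (X 0) P ∧ 0 < ∫ ω, |X 0 ω| ∂P ∧
            IdentDistrib (X 0) (fun ω => -X 0 ω) P P) ∨
         (MemLp (X 0) 2 P ∧ 0 < variance (X 0) P ∧ ∫ ω, X 0 ω ∂P = 0)) :
    ∀ᵐ ω ∂P,
      liminf (fun n => ((centreOfMass X n ω : ℝ) : EReal)) atTop = ⊥ ∧
      limsup (fun n => ((centreOfMass X n ω : ℝ) : EReal)) atTop = ⊤ ∧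
      (∀ x : ℝ, liminf (fun n => ((|centreOfMass X n ω - x| : ℝ) : EReal)) atTop = 0) ∧
      (∀ x : ℝ, ∀ ε : ℝ, 0 < ε → ∃ᶠ n in atTop, |centreOfMass X n ω - x| < ε) := by
  have hstep : IsAdmissibleStep P (X 0) := h
  have htop := hstep.ae_seqLimsup_eq_top hmeas hindep hident
  -- Both hypotheses survive negation, so the lower limit is handled by the walk with steps `-X i`.
  have htop' := IsAdmissibleStep.ae_seqLimsup_eq_top (X := fun i ω => -X i ω) hstep.neg
    (fun i => (hmeas i).neg) (hindep.comp (fun _ x => -x) fun _ => measurable_neg)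
    (fun i => (hident i).comp measurable_neg)
  have hslln := ae_tendsto_average hindep hident hstep.integrable hstep.integral_eq_zero
  filter_upwards [htop, htop', hslln] with ω hω hω' hav
  have hinc := tendsto_seqCentre_succ_sub hav
  have hneg : seqCentre (fun i => -X i ω) = fun n => -seqCentre (fun i => X i ω) n :=
    funext fun n => seqCentre_neg _ n
  unfold seqLimsup at hω'
  rw [hneg] at hω'
  have hlow : ∀ x : ℝ, ∃ᶠ n in atTop, seqCentre (fun i => X i ω) n < x := fun x =>
    (limsup_coe_eq_top_iff.1 hω' (-x)).mono fun n hn => neg_lt_neg_iff.1 hn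
  have hrec : ∀ x ε : ℝ, 0 < ε → ∃ᶠ n in atTop, |seqCentre (fun i => X i ω) n - x| < ε :=
    fun x ε hε => frequently_abs_sub_lt_of_increments hε hinc (hlow x)
      (limsup_coe_eq_top_iff.1 hω x)
  exact ⟨limsup_coe_neg_eq_top_iff.1 hω', hω, fun x => liminf_abs_sub_eq_zero (hrec x), hrec⟩
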